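/- Notation. A one-parameter qubit state $\sigma_t$ is a family of density matrices on $\mathbb{C}^2$, defined for $t$ near the true value $\theta$ and differentiable at $\theta$. Its quantum Fisher information (QFI) at $\theta$ is $F(\sigma_\theta)=\mathrm{Tr}(\sigma_\theta L^2)$, where $L$ is any Hermitian matrix with $\frac12(L\sigma_\theta+\sigma_\theta L)=\partial_\theta\sigma_\theta$. For a one-parameter qubit channel $\mathcal{E}_t$ (CPTP maps for $t$ near $\theta$, differentiable at $\theta$) put $F(\mathcal{E}_\theta)=\sup_{\rho}F(\mathcal{E}_\theta(\rho))$, the supremum being over parameter-independent density matrices $\rho$ on $\mathbb{C}^2$. For a fixed channel $\mathcal{N}$, the QFI contraction coefficient is $\eta(\mathcal{N})=\sup_{\sigma_\theta}F(\mathcal{N}(\sigma_\theta))/F(\sigma_\theta)$, the supremum being over one-parameter states with $F(\sigma_\theta)\neq 0$. A qubit channel $\mathcal{N}$ is strictly contractive if $\|\mathcal{N}(A)\|_1<\|A\|_1$ for every nonzero traceless Hermitian $A$, where $\|\cdot\|_1$ is the trace norm. Theorem. Let $\mathcal{E}_t$ be a one-parameter qubit channel such that $\mathcal{E}_\theta$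 is strictly contractive at the true value $\theta$. Then $\eta(\mathcal{E}_\theta)<1$, and for every $n$ $$\sup_{\mathcal{C}_1,\dots,\mathcal{C}_n}F(\mathcal{C}_n\circ\mathcal{E}_\theta\circ\cdots\circ\mathcal{C}_1\circ\mathcal{E}_\theta)\;\le\;\frac{F(\mathcal{E}_\theta)}{\bigl(1-\sqrt{\eta(\mathcal{E}_\theta)}\bigr)^2}\;<\;\infty ,$$ where the supremum is over arbitrary CPTP controls $\mathcal{C}_k$ on the qubit (no ancilla). The right-hand side does not depend on $n$, so the QFI is $O(1)$. Moreover a constant QFI is achievable: for every $n\ge 1$ the supremum is at least $F(\mathcal{E}_\theta)$. Explicitly, if $\psi$ is a density matrix, $n\ge 2$, $\mathcal{C}_{n-1}=\mathrm{Tr}(\cdot)\,\psi$ (which is a channel), $\mathcal{C}_n$ is the identity and the other controls are arbitrary channels, then $F(\mathcal{C}_n\circ\mathcal{E}_\theta\circ\cdots\circ\mathcal{C}_1\circ\mathcal{E}_\theta)=F(\mathcal{E}_\theta(\psi))$; and if $F(\mathcal{E}_\theta)>0$ there is a pure state $\psi$ with $F(\mathcal{E}_\theta(\psi))>0$. -/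

import Mathlib

open scoped ENNReal Topology Matrix ComplexOrder

noncomputable section

/-- A quantum state (density matrix): positive semidefinite with unit trace. -/
def IsState {d : Type*} [Fintype d] (ρ : Matrix d d ℂ) : Prop :=
  ρ.PosSemidef ∧ ρ.trace = 1

/-- Complete positivity: for every `k`, the ampliation of `Φ` to `k × k` block matrices with
blocks in `Matrix d d ℂ` (that is, `id_k ⊗ Φ`) preserves positive semidefiniteness. The block
matrix `X` is read as a matrix with scalar entries, indexed by `Fin k × d`. -/
def IsCompletelyPositive {d : Type*} [Fintype d]
    (Φ : Matrix d d ℂ →ₗ[ℂ] Matrix d d ℂ) : Prop :=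
  ∀ (k : ℕ) (X : Matrix (Fin k) (Fin k) (Matrix d d ℂ)),
    (Matrix.comp (Fin k) (Fin k) d d ℂ X).PosSemidef →
      (Matrix.comp (Fin k) (Fin k) d d ℂ (X.map Φ)).PosSemidef

/-- A quantum channel: a completely positive and trace preserving (CPTP) linear map. -/
def IsChannel {d : Type*} [Fintype d]
    (Φ : Matrix d d ℂ →ₗ[ℂ] Matrix d d ℂ) : Prop :=
  IsCompletelyPositive Φ ∧ ∀ A, (Φ A).trace = A.trace

/-- The trace norm `‖A‖₁ = Tr √(A† A)`, i.e. the sum of the singular values of `A`. -/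
def traceNorm {d : Type*} [Fintype d] [DecidableEq d] (A : Matrix d d ℂ) : ℝ :=
  ∑ i, √((Matrix.isHermitian_conjTranspose_mul_self A).eigenvalues i)

/-- Strict contractivity: `‖Φ(A)‖₁ < ‖A‖₁` for every nonzero traceless Hermitian `A`. -/
def IsStrictlyContractive {d : Type*} [Fintype d] [DecidableEq d]
    (Φ : Matrix d d ℂ →ₗ[ℂ] Matrix d d ℂ) : Prop :=
  ∀ A : Matrix d d ℂ, A.IsHermitian → A.trace = 0 → A ≠ 0 → traceNorm (Φ A) < traceNorm A

/-- Differentiability of a one-parameter family of matrices at `θ` (entrywise). -/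
def MatDifferentiableAt {d : Type*} (ρ : ℝ → Matrix d d ℂ) (θ : ℝ) : Prop :=
  ∀ i j, DifferentiableAt ℝ (fun t => ρ t i j) θ

/-- The (entrywise) derivative of a one-parameter family of matrices. -/
def matDeriv {d : Type*} (ρ : ℝ → Matrix d d ℂ) (θ : ℝ) : Matrix d d ℂ :=
  Matrix.of fun i j => deriv (fun t => ρ t i j) θ

/-- `ρ` is a one-parameter quantum state around the parameter value `θ`: states near `θ`,
differentiable at `θ`. -/
def IsStateFamilyAt {d : Type*} [Fintype d] (ρ : ℝ → Matrix d d ℂ) (θ : ℝ) : Prop :=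
  (∀ᶠ t in 𝓝 θ, IsState (ρ t)) ∧ MatDifferentiableAt ρ θ

/-- `E` is a one-parameter quantum channel around the parameter value `θ`: channels near `θ`,
differentiable at `θ`. -/
def IsChannelFamilyAt {d : Type*} [Fintype d]
    (E : ℝ → Matrix d d ℂ →ₗ[ℂ] Matrix d d ℂ) (θ : ℝ) : Prop :=
  (∀ᶠ t in 𝓝 θ, IsChannel (E t)) ∧ ∀ A, MatDifferentiableAt (fun t => E t A) θ

/-- `L` is a symmetric logarithmic derivative of the family `ρ` at `θ`:
`L` is Hermitian and `(L ρ_θ + ρ_θ L) / 2 = ∂_θ ρ_θ`. -/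
def IsSLD {d : Type*} [Fintype d] (ρ : ℝ → Matrix d d ℂ) (θ : ℝ) (L : Matrix d d ℂ) : Prop :=
  L.IsHermitian ∧ (1 / 2 : ℂ) • (L * ρ θ + ρ θ * L) = matDeriv ρ θ

/-- The quantum Fisher information of the family `ρ` at `θ`: the value `Tr (ρ_θ L²)` for a
symmetric logarithmic derivative `L`. The value does not depend on `L`, so the infimum over all
`L` is this common value (and it is `∞` if there is no such `L`). -/
def qfi {d : Type*} [Fintype d] (ρ : ℝ → Matrix d d ℂ) (θ : ℝ) : ℝ≥0∞ :=
  ⨅ (L : Matrix d d ℂ) (_ : IsSLD ρ θ L), ENNReal.ofReal (ρ θ * (L * L)).trace.re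

/-- The (ancilla-free) channel QFI: the supremum of the QFI of the output over all
parameter-independent input states. -/
def channelQFI {d : Type*} [Fintype d]
    (E : ℝ → Matrix d d ℂ →ₗ[ℂ] Matrix d d ℂ) (θ : ℝ) : ℝ≥0∞ :=
  ⨆ (ρ : Matrix d d ℂ) (_ : IsState ρ), qfi (fun t => E t ρ) θ

/-- The contraction coefficient of a (parameter-independent) channel `N` with respect to the QFI:
the supremum of `F(N(σ_θ)) / F(σ_θ)` over all one-parameter states with `F(σ_θ) ≠ 0`. -/
def qfiContraction {d : Type*} [Fintype d]
    (N : Matrix d d ℂ →ₗ[ℂ] Matrix d d ℂ) : ℝ≥0∞ :=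
  ⨆ (σ : ℝ → Matrix d d ℂ) (θ : ℝ) (_ : IsStateFamilyAt σ θ) (_ : qfi σ θ ≠ 0),
    qfi (fun t => N (σ t)) θ / qfi σ θ

/-- The ancilla-free sequential strategy `C_n ∘ E_θ ∘ ⋯ ∘ C_1 ∘ E_θ` (the identity for `n = 0`). -/
def sequential {d : Type*}
    (C : ℕ → Matrix d d ℂ →ₗ[ℂ] Matrix d d ℂ) (E : ℝ → Matrix d d ℂ →ₗ[ℂ] Matrix d d ℂ) :
    ℕ → ℝ → Matrix d d ℂ →ₗ[ℂ] Matrix d d ℂ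
  | 0, _ => LinearMap.id
  | n + 1, t => C (n + 1) ∘ₗ E t ∘ₗ sequential C E n t

/-- The optimal QFI `sup_{C_1, …, C_n} F(C_n ∘ E_θ ∘ ⋯ ∘ C_1 ∘ E_θ)` over all CPTP controls. -/
def optimalQFI {d : Type*} [Fintype d]
    (E : ℝ → Matrix d d ℂ →ₗ[ℂ] Matrix d d ℂ) (n : ℕ) (θ : ℝ) : ℝ≥0∞ :=
  ⨆ (C : ℕ → Matrix d d ℂ →ₗ[ℂ] Matrix d d ℂ) (_ : ∀ k, IsChannel (C k)),
    channelQFI (sequential C E n) θ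

/-- The replacement channel `X ↦ Tr(X) ψ`. -/
def replacement {d : Type*} [Fintype d] (ψ : Matrix d d ℂ) :
    Matrix d d ℂ →ₗ[ℂ] Matrix d d ℂ :=
  (Matrix.traceLinearMap d ℂ ℂ).smulRight ψ

end

/-! For a family of positive matrices with derivative D at ρ, the QFI is the least c ≥ 0 such that
(Re Tr BD)² ≤ c Re Tr(ρB²) for all Hermitian B (`QFIBound`): the SLD L represents D in the
semi-inner product Re Tr ρ(AB+BA)/2, and Cauchy–Schwarz is sharp at B = L. At fixed ρ, √F therefore
obeys the triangle inequality in D (`QFIBound.add`).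

The derivative of E_t(τ_t) is (∂E)(τ) + E(∂τ). The two terms contribute at most √F(E) and √η √F(τ),
and a control cannot increase the QFI. Hence √F_{n+1} ≤ √F(E) + √η √F_n with F_0 = 0, and the
sequence stays below the fixed point √F(E)/(1 - √η) (`qfi_sequential_le`).

For η < 1, a qubit channel acts on Bloch vectors by r ↦ c + Mr. Strict contractivity says ‖Mv‖ < ‖v‖
for v ≠ 0, so ‖M‖ < 1 by compactness, and positivity of the channel makes the QFI contract by the
factor ‖M‖ (`QFIBound.map_of_bloch`). Finiteness of F(E) comes from the QFI of the Choi matrix. For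
the lower bound, a replacement control erases the past and prepares a good input for the last use.
-/

open scoped Kronecker

/-! ### Variational form of the QFI and existence of the SLD -/

section QFIBound

variable {d : Type*} [Fintype d]

/-- The quadratic bound which characterises `qfi ≤ c`: `(Tr B D)² ≤ c Tr (ρ B²)` for every
Hermitian `B`. -/
def QFIBound (ρ D : Matrix d d ℂ) (c : ℝ) : Prop :=
  ∀ B : Matrix d d ℂ, B.IsHermitian → (B * D).trace.re ^ 2 ≤ c * (ρ * (B * B)).trace.re

theorem trace_mul_sq_nonneg {ρ B : Matrix d d ℂ} (hρ : ρ.PosSemidef) (hB : B.IsHermitian) :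
    0 ≤ (ρ * (B * B)).trace.re := by
  have h := (hρ.mul_mul_conjTranspose_same B).trace_nonneg
  rw [hB.eq, Matrix.mul_assoc, Matrix.trace_mul_comm, Matrix.mul_assoc] at h
  exact (Complex.le_def.1 h).1

/-- Cauchy–Schwarz: the quadratic s ↦ Tr ρ(A + sB)² is nonnegative, so its discriminant is not
positive. -/
theorem trace_mul_sym_sq_le {ρ A B : Matrix d d ℂ} (hρ : ρ.PosSemidef) (hA : A.IsHermitian)
    (hB : B.IsHermitian) :
    ((ρ * (A * B + B * A)).trace.re / 2) ^ 2 ≤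
      (ρ * (A * A)).trace.re * (ρ * (B * B)).trace.re := by
  have key : ∀ s : ℝ, 0 ≤ (ρ * (B * B)).trace.re * (s * s) +
      (ρ * (A * B + B * A)).trace.re * s + (ρ * (A * A)).trace.re := by
    intro s
    have hAB : (A + (s : ℂ) • B).IsHermitian := by
      refine hA.add ?_
      rw [Matrix.IsHermitian, Matrix.conjTranspose_smul, hB.eq]
      simp
    have h := trace_mul_sq_nonneg hρ hAB
    have e : (ρ * ((A + (s : ℂ) • B) * (A + (s : ℂ) • B))).trace =
        (ρ * (B * B)).trace * ((s * s : ℝ) : ℂ) + (ρ * (A * B + B * A)).trace * (s : ℂ) +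
          (ρ * (A * A)).trace := by
      simp only [Matrix.mul_add, Matrix.add_mul, Matrix.smul_mul, Matrix.mul_smul,
        Matrix.trace_add, Matrix.trace_smul, smul_eq_mul]
      push_cast
      ring
    rw [e] at h
    simpa [Complex.add_re, Complex.re_mul_ofReal] using h
  have := discrim_le_zero key
  rw [discrim] at this
  nlinarith

theorem IsSLD.trace_mul_deriv {ρ : ℝ → Matrix d d ℂ} {θ : ℝ} {L : Matrix d d ℂ}
    (hL : IsSLD ρ θ L) (B : Matrix d d ℂ) :
    (B * matDeriv ρ θ).trace.re = (ρ θ * (B * L + L * B)).trace.re / 2 := by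
  rw [← hL.2, Matrix.mul_smul, Matrix.trace_smul, Matrix.mul_add, Matrix.mul_add,
    Matrix.trace_add, Matrix.trace_add, ← Matrix.mul_assoc B L, Matrix.trace_mul_comm (B * L),
    ← Matrix.mul_assoc B (ρ θ), Matrix.trace_mul_comm (B * ρ θ), ← Matrix.mul_assoc L,
    Matrix.trace_mul_comm (L * B) (ρ θ), smul_eq_mul]
  rw [show (1 / 2 : ℂ) = ((1 / 2 : ℝ) : ℂ) by norm_num, Complex.re_ofReal_mul]
  ring

/-- Testing with B = L gives one direction, Cauchy–Schwarz the other. The left side does not mention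
L, whence the independence of the QFI from the choice of L. -/
theorem IsSLD.qfiBound_iff {ρ : ℝ → Matrix d d ℂ} {θ : ℝ} {L : Matrix d d ℂ}
    (hL : IsSLD ρ θ L) (hρ : (ρ θ).PosSemidef) {c : ℝ} (hc : 0 ≤ c) :
    QFIBound (ρ θ) (matDeriv ρ θ) c ↔ (ρ θ * (L * L)).trace.re ≤ c := by
  have h0 := trace_mul_sq_nonneg hρ hL.1
  constructor
  · intro h
    have h1 := h L hL.1
    rw [hL.trace_mul_deriv, Matrix.mul_add, Matrix.trace_add, Complex.add_re] at h1
    rcases h0.eq_or_lt with h0 | h0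
    · rw [← h0]; exact hc
    · nlinarith
  · intro h B hB
    rw [hL.trace_mul_deriv]
    have h1 := trace_mul_sym_sq_le hρ hB hL.1
    have h2 := trace_mul_sq_nonneg hρ hB
    nlinarith [mul_le_mul_of_nonneg_left h h2]

theorem IsSLD.qfi_eq {ρ : ℝ → Matrix d d ℂ} {θ : ℝ} {L : Matrix d d ℂ}
    (hL : IsSLD ρ θ L) (hρ : (ρ θ).PosSemidef) :
    qfi ρ θ = ENNReal.ofReal (ρ θ * (L * L)).trace.re := by
  refine le_antisymm (iInf₂_le L hL) (le_iInf₂ fun L' hL' => ENNReal.ofReal_le_ofReal ?_)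
  have h0 := trace_mul_sq_nonneg hρ hL'.1
  exact (hL.qfiBound_iff hρ h0).1 ((hL'.qfiBound_iff hρ h0).2 le_rfl)

theorem isHermitian_matDeriv {d : Type*} {ρ : ℝ → Matrix d d ℂ} {θ : ℝ}
    (hρ : ∀ᶠ t in 𝓝 θ, (ρ t).PosSemidef) (hd : MatDifferentiableAt ρ θ) :
    (matDeriv ρ θ).IsHermitian := by
  ext i j
  have h1 := (hd j i).hasDerivAt.star
  have h2 : (fun t => ρ t i j) =ᶠ[𝓝 θ] fun t => star (ρ t j i) := by
    filter_upwards [hρ] with t ht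
    exact (ht.1.apply i j).symm
  simp only [Matrix.conjTranspose_apply, matDeriv, Matrix.of_apply]
  rw [h2.deriv_eq]
  exact h1.deriv.symm

theorem hasDerivAt_quadratic {ρ : ℝ → Matrix d d ℂ} {θ : ℝ} (hd : MatDifferentiableAt ρ θ)
    (x y : d → ℂ) :
    HasDerivAt (fun t => star x ⬝ᵥ ρ t *ᵥ y) (star x ⬝ᵥ matDeriv ρ θ *ᵥ y) θ := by
  simp only [dotProduct, Matrix.mulVec]
  refine HasDerivAt.fun_sum fun i _ => HasDerivAt.const_mul _ (HasDerivAt.fun_sum fun j _ => ?_)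
  exact (hd i j).hasDerivAt.mul_const _

/-- The nonnegative function t ↦ ⟨x, ρ_t x⟩ vanishes at θ, so it has a local minimum there. -/
theorem matDeriv_quadratic_eq_zero {ρ : ℝ → Matrix d d ℂ} {θ : ℝ}
    (hρ : ∀ᶠ t in 𝓝 θ, (ρ t).PosSemidef) (hd : MatDifferentiableAt ρ θ) {x : d → ℂ}
    (hx : ρ θ *ᵥ x = 0) : star x ⬝ᵥ matDeriv ρ θ *ᵥ x = 0 := by
  have h1 := hasDerivAt_quadratic hd x x
  have hre : HasDerivAt (fun t => (star x ⬝ᵥ ρ t *ᵥ x).re)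
      (star x ⬝ᵥ matDeriv ρ θ *ᵥ x).re θ :=
    (Complex.reCLM.hasFDerivAt.comp_hasDerivAt θ h1)
  have hmin : IsLocalMin (fun t => (star x ⬝ᵥ ρ t *ᵥ x).re) θ := by
    filter_upwards [hρ] with t ht
    simp only [hx, dotProduct_zero, Complex.zero_re]
    exact (Complex.le_def.1 (ht.dotProduct_mulVec_nonneg x)).1
  have h3 := hmin.hasDerivAt_eq_zero hre
  have h4 := (isHermitian_matDeriv hρ hd).im_star_dotProduct_mulVec_self x
  exact Complex.ext h3 h4

/-- Polarisation on the kernel, with the vectors x + y and x + iy. -/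
theorem matDeriv_sesquilinear_eq_zero {ρ : ℝ → Matrix d d ℂ} {θ : ℝ}
    (hρ : ∀ᶠ t in 𝓝 θ, (ρ t).PosSemidef) (hd : MatDifferentiableAt ρ θ) {x y : d → ℂ}
    (hx : ρ θ *ᵥ x = 0) (hy : ρ θ *ᵥ y = 0) : star x ⬝ᵥ matDeriv ρ θ *ᵥ y = 0 := by
  have h (c : ℂ) := matDeriv_quadratic_eq_zero (x := x + c • y) hρ hd
    (by rw [Matrix.mulVec_add, Matrix.mulVec_smul, hx, hy]; simp)
  have hxx := matDeriv_quadratic_eq_zero hρ hd hx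
  have hyy := matDeriv_quadratic_eq_zero hρ hd hy
  have h1 := h 1
  have h2 := h Complex.I
  simp only [star_add, star_smul, Matrix.mulVec_add, Matrix.mulVec_smul, add_dotProduct,
    dotProduct_add, smul_dotProduct, dotProduct_smul, hxx, hyy, smul_eq_mul, star_one] at h1 h2
  have h3 : star Complex.I = -Complex.I := Complex.conj_I
  rw [h3] at h2
  linear_combination (1 / 2 : ℂ) * h1 - (Complex.I / 2) * h2 +
    (1 / 2 : ℂ) * (star x ⬝ᵥ matDeriv ρ θ *ᵥ y - star y ⬝ᵥ matDeriv ρ θ *ᵥ x) * Complex.I_sq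

/-- A differentiable family of positive semidefinite matrices has a symmetric logarithmic
derivative. -/
theorem exists_isSLD [DecidableEq d] {ρ : ℝ → Matrix d d ℂ} {θ : ℝ}
    (hρ : ∀ᶠ t in 𝓝 θ, (ρ t).PosSemidef) (hd : MatDifferentiableAt ρ θ) :
    ∃ L, IsSLD ρ θ L := by
  have hR : (ρ θ).PosSemidef := hρ.self_of_nhds
  have hH : (ρ θ).IsHermitian := hR.1
  have hD := isHermitian_matDeriv hρ hd
  set D := matDeriv ρ θ with hDdef
  let U : Matrix d d ℂ := (hH.eigenvectorUnitary : Matrix d d ℂ)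
  let e : d → ℝ := hH.eigenvalues
  have hU1 : Uᴴ * U = 1 := Unitary.coe_star_mul_self hH.eigenvectorUnitary
  have hU2 : U * Uᴴ = 1 := Unitary.coe_mul_star_self hH.eigenvectorUnitary
  have hspec : ρ θ = U * Matrix.diagonal (fun i => (e i : ℂ)) * Uᴴ := hH.spectral_theorem
  have he : ∀ i, 0 ≤ e i := hR.eigenvalues_nonneg
  set Q : Matrix d d ℂ := Uᴴ * D * U with hQ
  have hQH : Q.IsHermitian := by
    have := Matrix.isHermitian_conjTranspose_mul_mul U hD
    exact this
  -- The eigenvalues are nonnegative, so both vanish and the entry lies in the kernel block of the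
  -- derivative.
  have hQ0 : ∀ i j, e i + e j = 0 → Q i j = 0 := by
    intro i j hij
    have hi : e i = 0 := by linarith [he i, he j]
    have hj : e j = 0 := by linarith [he i, he j]
    have hker : ∀ k, e k = 0 → ρ θ *ᵥ (fun a => U a k) = 0 := by
      intro k hk
      have : ρ θ * U = U * Matrix.diagonal (fun i => (e i : ℂ)) := by
        rw [hspec, Matrix.mul_assoc, hU1, Matrix.mul_one]
      ext a
      have h2 := congrFun (congrFun this a) k
      rw [Matrix.mul_diagonal, hk] at h2
      simpa [Matrix.mul_apply, Matrix.mulVec, dotProduct] using h2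
    have := matDeriv_sesquilinear_eq_zero hρ hd (hker i hi) (hker j hj)
    rw [← this, hQ, Matrix.mul_assoc, Matrix.mul_apply]
    rfl
  -- In the eigenbasis the SLD equation reads (e_i + e_j) K_ij = 2 Q_ij. Where the denominator is 0,
  -- division returns 0, which is a solution because `hQ0` gives Q_ij = 0.
  let K : Matrix d d ℂ := Matrix.of fun i j => 2 * Q i j / ((e i : ℂ) + e j)
  have hK : K.IsHermitian := by
    ext i j
    have := hQH.apply i j
    simp only [Matrix.conjTranspose_apply, K, Matrix.of_apply, ← this]
    simp [add_comm]
  refine ⟨U * K * Uᴴ, ?_, ?_⟩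
  · exact Matrix.isHermitian_mul_mul_conjTranspose U hK
  · have hKQ : (1 / 2 : ℂ) • (K * Matrix.diagonal (fun i => (e i : ℂ)) +
        Matrix.diagonal (fun i => (e i : ℂ)) * K) = Q := by
      ext i j
      simp only [Matrix.smul_apply, Matrix.add_apply, Matrix.mul_diagonal, Matrix.diagonal_mul,
        K, Matrix.of_apply, smul_eq_mul]
      by_cases h : e i + e j = 0
      · rw [hQ0 i j h]; simp
      · have h' : (e i : ℂ) + e j ≠ 0 := by exact_mod_cast h
        field_simp
        ring
    have hDQ : D = U * Q * Uᴴ := by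
      rw [hQ]
      simp only [Matrix.mul_assoc, hU2, Matrix.mul_one]
      rw [← Matrix.mul_assoc, hU2, Matrix.one_mul]
    have hmul : ∀ X Y : Matrix d d ℂ, U * X * Uᴴ * (U * Y * Uᴴ) = U * (X * Y) * Uᴴ := by
      intro X Y
      simp only [Matrix.mul_assoc]
      rw [← Matrix.mul_assoc Uᴴ U, hU1, Matrix.one_mul]
    rw [← hDdef, hDQ, ← hKQ, hspec, hmul, hmul, Matrix.mul_smul, Matrix.smul_mul,
      Matrix.mul_add, Matrix.add_mul]

theorem qfi_le_ofReal_iff {ρ : ℝ → Matrix d d ℂ} {θ : ℝ}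
    (hρ : ∀ᶠ t in 𝓝 θ, (ρ t).PosSemidef) (hd : MatDifferentiableAt ρ θ) {c : ℝ} (hc : 0 ≤ c) :
    qfi ρ θ ≤ ENNReal.ofReal c ↔ QFIBound (ρ θ) (matDeriv ρ θ) c := by
  classical
  obtain ⟨L, hL⟩ := exists_isSLD hρ hd
  rw [hL.qfi_eq hρ.self_of_nhds, hL.qfiBound_iff hρ.self_of_nhds hc,
    ENNReal.ofReal_le_ofReal_iff hc]

theorem qfi_ne_top {ρ : ℝ → Matrix d d ℂ} {θ : ℝ}
    (hρ : ∀ᶠ t in 𝓝 θ, (ρ t).PosSemidef) (hd : MatDifferentiableAt ρ θ) : qfi ρ θ ≠ ∞ := by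
  classical
  obtain ⟨L, hL⟩ := exists_isSLD hρ hd
  rw [hL.qfi_eq hρ.self_of_nhds]
  exact ENNReal.ofReal_ne_top

/-- With c = 0, the test B = D gives Tr D² = 0. -/
theorem qfi_eq_zero_iff {ρ : ℝ → Matrix d d ℂ} {θ : ℝ}
    (hρ : ∀ᶠ t in 𝓝 θ, (ρ t).PosSemidef) (hd : MatDifferentiableAt ρ θ) :
    qfi ρ θ = 0 ↔ matDeriv ρ θ = 0 := by
  rw [← nonpos_iff_eq_zero, ← ENNReal.ofReal_zero, qfi_le_ofReal_iff hρ hd le_rfl]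
  have hD := isHermitian_matDeriv hρ hd
  constructor
  · intro h
    have h1 := h _ hD
    rw [zero_mul] at h1
    have h2 : (matDeriv ρ θ * matDeriv ρ θ).trace.re = 0 := by nlinarith
    have h3 := Matrix.posSemidef_conjTranspose_mul_self (matDeriv ρ θ)
    rw [← Matrix.trace_conjTranspose_mul_self_eq_zero_iff]
    have h4 := Complex.le_def.1 h3.trace_nonneg
    rw [hD.eq] at h4 ⊢
    exact Complex.ext h2 h4.2.symm
  · intro h B _
    simp [h]

/-- The triangle inequality for the square root of the quantum Fisher information. -/
theorem QFIBound.add {ρ D₁ D₂ : Matrix d d ℂ} (hρ : ρ.PosSemidef) {a b : ℝ} (ha : 0 ≤ a)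
    (hb : 0 ≤ b) (h₁ : QFIBound ρ D₁ (a ^ 2)) (h₂ : QFIBound ρ D₂ (b ^ 2)) :
    QFIBound ρ (D₁ + D₂) ((a + b) ^ 2) := by
  intro B hB
  have hv := trace_mul_sq_nonneg hρ hB
  set v := (ρ * (B * B)).trace.re
  have e : ∀ a : ℝ, a ^ 2 * v = (a * √v) ^ 2 := fun a => by rw [mul_pow, Real.sq_sqrt hv]
  have k₁ := h₁ B hB
  have k₂ := h₂ B hB
  rw [e] at k₁ k₂ ⊢
  have k₁ := abs_le.1 <| abs_le_of_sq_le_sq k₁ (by positivity)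
  have k₂ := abs_le.1 <| abs_le_of_sq_le_sq k₂ (by positivity)
  rw [Matrix.mul_add, Matrix.trace_add, Complex.add_re]
  refine sq_le_sq' ?_ ?_ <;> linarith [k₁.1, k₁.2, k₂.1, k₂.2]

end QFIBound

/-! ### Bloch representation of qubit matrices -/

/-- The traceless Hermitian `2 × 2` matrix with a given Bloch vector. -/
def pauli : EuclideanSpace ℝ (Fin 3) →ₗ[ℝ] Matrix (Fin 2) (Fin 2) ℂ where
  toFun v := !![(v 2 : ℂ), v 0 - v 1 * Complex.I; v 0 + v 1 * Complex.I, -v 2]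
  map_add' u v := by
    ext i j
    fin_cases i <;> fin_cases j <;> simp <;> ring
  map_smul' c v := by
    ext i j
    fin_cases i <;> fin_cases j <;> simp <;> ring

theorem pauli_apply (v : EuclideanSpace ℝ (Fin 3)) :
    pauli v = !![(v 2 : ℂ), v 0 - v 1 * Complex.I; v 0 + v 1 * Complex.I, -v 2] := rfl

/-- The Bloch vector of a `2 × 2` matrix which is Hermitian and traceless. -/
def blochVector : Matrix (Fin 2) (Fin 2) ℂ →ₗ[ℝ] EuclideanSpace ℝ (Fin 3) where
  toFun A := !₂[(A 1 0).re, (A 1 0).im, (A 0 0).re]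
  map_add' A B := by ext i; fin_cases i <;> simp
  map_smul' c A := by ext i; fin_cases i <;> simp

theorem isHermitian_pauli (v : EuclideanSpace ℝ (Fin 3)) : (pauli v).IsHermitian := by
  ext i j
  fin_cases i <;> fin_cases j <;> simp [pauli_apply, Complex.ext_iff]

theorem trace_pauli (v : EuclideanSpace ℝ (Fin 3)) : (pauli v).trace = 0 := by
  simp [pauli_apply, Matrix.trace_fin_two]

theorem pauli_blochVector {A : Matrix (Fin 2) (Fin 2) ℂ} (hA : A.IsHermitian)
    (ht : A.trace = 0) : pauli (blochVector A) = A := by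
  have h00 := congrArg Complex.im (hA.apply 0 0)
  have h01 := hA.apply 0 1
  rw [Matrix.trace_fin_two] at ht
  have h11 : A 1 1 = -A 0 0 := by linear_combination ht
  simp only [RCLike.star_def, Complex.conj_im] at h00
  have h0 : (A 0 0).im = 0 := by linarith
  ext i j
  fin_cases i <;> fin_cases j <;>
    simp [pauli_apply, blochVector, Complex.ext_iff, ← h01, h11, h0]

theorem exists_eq_smul_one_add_pauli {A : Matrix (Fin 2) (Fin 2) ℂ} (hA : A.IsHermitian) :
    ∃ (a : ℝ) (v : EuclideanSpace ℝ (Fin 3)), A = (a : ℂ) • 1 + pauli v := by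
  have htr : (A.trace.re : ℂ) = A.trace := by
    have h := congrArg Matrix.trace hA.eq
    rw [Matrix.trace_conjTranspose] at h
    exact Complex.conj_eq_iff_re.1 h
  refine ⟨A.trace.re / 2, blochVector (A - ((A.trace.re / 2 : ℝ) : ℂ) • 1), ?_⟩
  rw [pauli_blochVector]
  · abel
  · refine hA.sub ?_
    rw [Matrix.IsHermitian, Matrix.conjTranspose_smul]
    simp
  · rw [Matrix.trace_sub, Matrix.trace_smul]
    push_cast
    rw [htr]
    simp

theorem inner_fin_three (u v : EuclideanSpace ℝ (Fin 3)) :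
    inner ℝ u v = u 0 * v 0 + u 1 * v 1 + u 2 * v 2 := by
  simp [PiLp.inner_apply, Fin.sum_univ_three, mul_comm]

theorem norm_sq_fin_three (v : EuclideanSpace ℝ (Fin 3)) :
    ‖v‖ ^ 2 = v 0 * v 0 + v 1 * v 1 + v 2 * v 2 := by
  rw [← real_inner_self_eq_norm_sq, inner_fin_three]

theorem pauli_mul_self (v : EuclideanSpace ℝ (Fin 3)) :
    pauli v * pauli v = ((‖v‖ ^ 2 : ℝ) : ℂ) • 1 := by
  rw [norm_sq_fin_three]
  ext i j
  fin_cases i <;> fin_cases j <;>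
    simp [pauli_apply, Complex.ext_iff] <;> first | ring1 | exact ⟨by ring, by ring⟩

theorem trace_pauli_mul_pauli (u v : EuclideanSpace ℝ (Fin 3)) :
    (pauli u * pauli v).trace.re = 2 * inner ℝ u v := by
  rw [inner_fin_three]
  simp [pauli_apply, Matrix.trace_fin_two]
  ring

/-- The value equals (a + ⟨b, r⟩)² + ‖b‖² - ⟨b, r⟩², so its minimum over a is ‖b‖² - ⟨b, r⟩². -/
theorem trace_pauli_sq (r b : EuclideanSpace ℝ (Fin 3)) (a : ℝ) :
    (((1 / 2 : ℂ) • (1 + pauli r)) *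
      (((a : ℂ) • 1 + pauli b) * ((a : ℂ) • 1 + pauli b))).trace.re =
      a ^ 2 + ‖b‖ ^ 2 + 2 * a * inner ℝ b r := by
  have e : ((1 / 2 : ℂ) • (1 + pauli r)) *
      (((a : ℂ) • 1 + pauli b) * ((a : ℂ) • 1 + pauli b)) =
      ((1 / 2 : ℝ) : ℂ) • (((a ^ 2 + ‖b‖ ^ 2 : ℝ) : ℂ) • (1 + pauli r) +
        ((2 * a : ℝ) : ℂ) • (pauli b + pauli r * pauli b)) := by
    simp only [add_mul, mul_add, smul_mul_assoc, mul_smul_comm, pauli_mul_self, one_mul, mul_one]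
    push_cast
    module
  rw [e]
  simp only [Matrix.trace_smul, Matrix.trace_add, trace_pauli, smul_eq_mul, Complex.re_ofReal_mul,
    Complex.add_re, trace_pauli_mul_pauli, real_inner_comm]
  simp
  ring

theorem posSemidef_smul_one_add_pauli {a : ℝ} {v : EuclideanSpace ℝ (Fin 3)} (h : ‖v‖ ≤ a) :
    ((a : ℂ) • 1 + pauli v).PosSemidef := by
  have h1 : ((‖v‖ : ℂ) • (1 : Matrix (Fin 2) (Fin 2) ℂ) + pauli v).PosSemidef := by
    rcases eq_or_ne v 0 with rfl | hv
    · simpa using Matrix.PosSemidef.zero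
    have hn : (‖v‖ : ℂ) ≠ 0 := by simpa using hv
    have h2 := Matrix.posSemidef_conjTranspose_mul_self
      ((‖v‖ : ℂ) • (1 : Matrix (Fin 2) (Fin 2) ℂ) + pauli v)
    have hc : (0 : ℂ) ≤ ((1 / (2 * ‖v‖) : ℝ) : ℂ) := by
      rw [Complex.zero_le_real]; positivity
    have h3 := h2.smul hc
    -- Since (pauli v)² = ‖v‖², the matrix ‖v‖ + pauli v is its own square up to the factor 2‖v‖.
    have e : ((1 / (2 * ‖v‖) : ℝ) : ℂ) • (((‖v‖ : ℂ) • (1 : Matrix (Fin 2) (Fin 2) ℂ) + pauli v)ᴴ *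
        ((‖v‖ : ℂ) • (1 : Matrix (Fin 2) (Fin 2) ℂ) + pauli v)) =
        (‖v‖ : ℂ) • (1 : Matrix (Fin 2) (Fin 2) ℂ) + pauli v := by
      have h4 : ((‖v‖ : ℂ) • (1 : Matrix (Fin 2) (Fin 2) ℂ) + pauli v)ᴴ =
          (‖v‖ : ℂ) • 1 + pauli v := by
        rw [Matrix.conjTranspose_add, (isHermitian_pauli v).eq, Matrix.conjTranspose_smul]
        simp
      rw [h4]
      simp only [add_mul, mul_add, smul_mul_assoc, mul_smul_comm, pauli_mul_self, one_mul, mul_one]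
      push_cast
      match_scalars <;> field_simp <;> ring
    rwa [e] at h3
  have h2 : (((a - ‖v‖ : ℝ) : ℂ) • (1 : Matrix (Fin 2) (Fin 2) ℂ)).PosSemidef :=
    Matrix.PosSemidef.one.smul (Complex.zero_le_real.2 (sub_nonneg.2 h))
  have := h1.add h2
  have e : (a : ℂ) • (1 : Matrix (Fin 2) (Fin 2) ℂ) + pauli v = (‖v‖ : ℂ) • 1 + pauli v +
      ((a - ‖v‖ : ℝ) : ℂ) • 1 := by
    push_cast
    module
  rwa [e]

theorem norm_le_of_posSemidef {a : ℝ} {v : EuclideanSpace ℝ (Fin 3)}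
    (h : ((a : ℂ) • 1 + pauli v).PosSemidef) : ‖v‖ ≤ a := by
  have h1 := (Complex.le_def.1 h.det_nonneg).1
  have h2 := (Complex.le_def.1 h.trace_nonneg).1
  have h3 := norm_sq_fin_three v
  rw [Matrix.det_fin_two] at h1
  rw [Matrix.trace_fin_two] at h2
  simp [pauli_apply] at h1 h2
  refine abs_le_of_sq_le_sq' (a := ‖v‖) ?_ (by linarith) |>.2
  nlinarith

theorem IsState.exists_bloch {ρ : Matrix (Fin 2) (Fin 2) ℂ} (h : IsState ρ) :
    ∃ r : EuclideanSpace ℝ (Fin 3), ‖r‖ ≤ 1 ∧ ρ = (1 / 2 : ℂ) • (1 + pauli r) := by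
  obtain ⟨a, v, hv⟩ := exists_eq_smul_one_add_pauli h.1.1
  have ha : a = 1 / 2 := by
    have := h.2
    rw [hv, Matrix.trace_add, trace_pauli, Matrix.trace_smul] at this
    simp at this
    have h2 : a * 2 = 1 := by simpa using congrArg Complex.re this
    linarith
  subst ha
  have hp := h.1
  rw [hv] at hp
  have hn := norm_le_of_posSemidef hp
  refine ⟨(2 : ℝ) • v, ?_, ?_⟩
  · rw [norm_smul, Real.norm_eq_abs, abs_of_pos two_pos]
    linarith
  · rw [hv, map_smul, smul_add, ← Complex.coe_smul, smul_smul]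
    norm_num

theorem traceNorm_pauli (v : EuclideanSpace ℝ (Fin 3)) : traceNorm (pauli v) = 2 * ‖v‖ := by
  have h : ∀ i, (Matrix.isHermitian_conjTranspose_mul_self (pauli v)).eigenvalues i = ‖v‖ ^ 2 := by
    intro i
    have hH := Matrix.isHermitian_conjTranspose_mul_self (pauli v)
    have h1 := hH.mulVec_eigenvectorBasis i
    have h2 : (pauli v)ᴴ * pauli v = ((‖v‖ ^ 2 : ℝ) : ℂ) • 1 := by
      rw [(isHermitian_pauli v).eq, pauli_mul_self]
    have h0 := hH.eigenvectorBasis.orthonormal.ne_zero i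
    generalize hH.eigenvectorBasis i = x at h1 h0
    obtain ⟨j, hj⟩ : ∃ j, x j ≠ 0 := by
      by_contra! hc
      exact h0 (by ext j; simp [hc j])
    generalize hH.eigenvalues i = e at h1 ⊢
    rw [h2] at h1
    have h3 := congrFun h1 j
    rw [Matrix.smul_mulVec, Matrix.one_mulVec, ← Complex.coe_smul] at h3
    have h4 := mul_right_cancel₀ hj h3
    exact (Complex.ofReal_injective h4).symm
  simp only [traceNorm, h, Finset.sum_const, Real.sqrt_sq (norm_nonneg v)]
  simp

/-! ### Product rule for channel families and calculus of state families -/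

theorem apply_eq_sum {d : Type*} [Fintype d] [DecidableEq d]
    (Φ : Matrix d d ℂ →ₗ[ℂ] Matrix d d ℂ) (A : Matrix d d ℂ) (a b : d) :
    Φ A a b = ∑ i, ∑ j, A i j * Φ (Matrix.single i j 1) a b := by
  conv_lhs => rw [Matrix.matrix_eq_sum_single A]
  simp only [map_sum, Matrix.sum_apply]
  refine Finset.sum_congr rfl fun i _ => Finset.sum_congr rfl fun j _ => ?_
  rw [← mul_one (A i j), ← smul_eq_mul, ← Matrix.smul_single, map_smul]
  simp

theorem hasDerivAt_apply {d : Type*} [Fintype d] [DecidableEq d]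
    {E : ℝ → Matrix d d ℂ →ₗ[ℂ] Matrix d d ℂ} {τ : ℝ → Matrix d d ℂ} {θ : ℝ}
    (hE : ∀ A, MatDifferentiableAt (fun t => E t A) θ) (hτ : MatDifferentiableAt τ θ) (a b : d) :
    HasDerivAt (fun t => E t (τ t) a b)
      ((matDeriv (fun t => E t (τ θ)) θ + E θ (matDeriv τ θ)) a b) θ := by
  have h1 : ∀ σ : ℝ → Matrix d d ℂ, MatDifferentiableAt σ θ → HasDerivAt (fun t => E t (σ t) a b)
      (∑ i, ∑ j, (matDeriv σ θ i j * E θ (Matrix.single i j 1) a b +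
        σ θ i j * matDeriv (fun t => E t (Matrix.single i j 1)) θ a b)) θ := by
    intro σ hσ
    simp only [fun t => apply_eq_sum (E t) (σ t) a b]
    refine HasDerivAt.fun_sum fun i _ => HasDerivAt.fun_sum fun j _ => ?_
    exact (hσ i j).hasDerivAt.mul (hE _ a b).hasDerivAt
  convert h1 τ hτ using 1
  -- The constant family isolates the half of the product rule where only the channel varies.
  have h2 := h1 (fun _ => τ θ) fun i j => differentiableAt_const _
  have h3 : matDeriv (fun _ : ℝ => τ θ) θ = 0 := by
    ext i j
    simp [matDeriv]
  rw [h3] at h2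
  rw [Matrix.add_apply, matDeriv, Matrix.of_apply, h2.deriv, apply_eq_sum (E θ)]
  simp only [Finset.sum_add_distrib]
  simp [add_comm]

theorem MatDifferentiableAt.apply {d : Type*} [Fintype d] [DecidableEq d]
    {E : ℝ → Matrix d d ℂ →ₗ[ℂ] Matrix d d ℂ} {τ : ℝ → Matrix d d ℂ} {θ : ℝ}
    (hE : ∀ A, MatDifferentiableAt (fun t => E t A) θ) (hτ : MatDifferentiableAt τ θ) :
    MatDifferentiableAt (fun t => E t (τ t)) θ := fun a b =>
  (hasDerivAt_apply hE hτ a b).differentiableAt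

theorem matDeriv_apply {d : Type*} [Fintype d] [DecidableEq d]
    {E : ℝ → Matrix d d ℂ →ₗ[ℂ] Matrix d d ℂ} {τ : ℝ → Matrix d d ℂ} {θ : ℝ}
    (hE : ∀ A, MatDifferentiableAt (fun t => E t A) θ) (hτ : MatDifferentiableAt τ θ) :
    matDeriv (fun t => E t (τ t)) θ = matDeriv (fun t => E t (τ θ)) θ + E θ (matDeriv τ θ) := by
  ext a b
  exact (hasDerivAt_apply hE hτ a b).deriv

theorem matDifferentiableAt_const {d : Type*} (A : Matrix d d ℂ) (θ : ℝ) :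
    MatDifferentiableAt (fun _ => A) θ := fun _ _ => differentiableAt_const _

theorem matDeriv_const {d : Type*} (A : Matrix d d ℂ) (θ : ℝ) :
    matDeriv (fun _ => A) θ = 0 := by
  ext i j
  simp [matDeriv]

theorem matDeriv_map {d : Type*} [Fintype d] [DecidableEq d]
    (N : Matrix d d ℂ →ₗ[ℂ] Matrix d d ℂ) {τ : ℝ → Matrix d d ℂ} {θ : ℝ}
    (hτ : MatDifferentiableAt τ θ) : matDeriv (fun t => N (τ t)) θ = N (matDeriv τ θ) := by
  rw [matDeriv_apply (E := fun _ => N) (fun _ => matDifferentiableAt_const _ θ) hτ,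
    matDeriv_const, zero_add]

theorem IsCompletelyPositive.map_posSemidef {d : Type*} [Fintype d]
    {Φ : Matrix d d ℂ →ₗ[ℂ] Matrix d d ℂ} (hΦ : IsCompletelyPositive Φ) {A : Matrix d d ℂ}
    (hA : A.PosSemidef) : (Φ A).PosSemidef := by
  have h := hΦ 1 (fun _ _ => A) (hA.submatrix Prod.snd)
  exact h.submatrix fun i => ((0 : Fin 1), i)

theorem IsChannel.map_isState {d : Type*} [Fintype d]
    {Φ : Matrix d d ℂ →ₗ[ℂ] Matrix d d ℂ} (hΦ : IsChannel Φ) {ρ : Matrix d d ℂ}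
    (hρ : IsState ρ) : IsState (Φ ρ) :=
  ⟨hΦ.1.map_posSemidef hρ.1, (hΦ.2 ρ).trans hρ.2⟩

theorem IsChannelFamilyAt.isStateFamilyAt {d : Type*} [Fintype d] [DecidableEq d]
    {E : ℝ → Matrix d d ℂ →ₗ[ℂ] Matrix d d ℂ} {θ : ℝ} (hE : IsChannelFamilyAt E θ)
    {τ : ℝ → Matrix d d ℂ} (hτ : IsStateFamilyAt τ θ) :
    IsStateFamilyAt (fun t => E t (τ t)) θ := by
  refine ⟨?_, hτ.2.apply hE.2⟩
  filter_upwards [hE.1, hτ.1] with t h1 h2 using h1.map_isState h2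

theorem isStateFamilyAt_const {d : Type*} [Fintype d] {ρ : Matrix d d ℂ} (hρ : IsState ρ)
    (θ : ℝ) : IsStateFamilyAt (fun _ => ρ) θ :=
  ⟨Filter.Eventually.of_forall fun _ => hρ, matDifferentiableAt_const ρ θ⟩

theorem IsChannel.isChannelFamilyAt {d : Type*} [Fintype d]
    {N : Matrix d d ℂ →ₗ[ℂ] Matrix d d ℂ} (hN : IsChannel N) (θ : ℝ) :
    IsChannelFamilyAt (fun _ => N) θ :=
  ⟨Filter.Eventually.of_forall fun _ => hN, fun _ => matDifferentiableAt_const _ θ⟩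

theorem IsStateFamilyAt.posSemidef {d : Type*} [Fintype d] {ρ : ℝ → Matrix d d ℂ} {θ : ℝ}
    (h : IsStateFamilyAt ρ θ) : ∀ᶠ t in 𝓝 θ, (ρ t).PosSemidef := h.1.mono fun _ ht => ht.1

theorem matDeriv_congr {d : Type*} {ρ σ : ℝ → Matrix d d ℂ} {θ : ℝ} (h : ρ =ᶠ[𝓝 θ] σ) :
    matDeriv ρ θ = matDeriv σ θ := by
  ext i j
  exact Filter.EventuallyEq.deriv_eq (h.mono fun t ht => congrFun (congrFun ht i) j)

theorem qfi_congr {d : Type*} [Fintype d] {ρ σ : ℝ → Matrix d d ℂ} {θ : ℝ} (h : ρ =ᶠ[𝓝 θ] σ) :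
    qfi ρ θ = qfi σ θ := by
  simp only [qfi, IsSLD, matDeriv_congr h, h.self_of_nhds]

theorem IsStateFamilyAt.trace_matDeriv {d : Type*} [Fintype d] {ρ : ℝ → Matrix d d ℂ} {θ : ℝ}
    (h : IsStateFamilyAt ρ θ) : (matDeriv ρ θ).trace = 0 := by
  have h1 : HasDerivAt (fun t => (ρ t).trace) (matDeriv ρ θ).trace θ :=
    HasDerivAt.fun_sum fun i _ => (h.2 i i).hasDerivAt
  have h2 : (fun t => (ρ t).trace) =ᶠ[𝓝 θ] fun _ => 1 := h.1.mono fun t ht => ht.2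
  rw [← h1.deriv, h2.deriv_eq, deriv_const]

/-! ### Contraction of the QFI under qubit channels -/

theorem IsChannel.exists_bloch {N : Matrix (Fin 2) (Fin 2) ℂ →ₗ[ℂ] Matrix (Fin 2) (Fin 2) ℂ}
    (hN : IsChannel N) :
    ∃ (M : EuclideanSpace ℝ (Fin 3) →L[ℝ] EuclideanSpace ℝ (Fin 3))
      (c : EuclideanSpace ℝ (Fin 3)),
      N 1 = 1 + pauli c ∧ ∀ v, N (pauli v) = pauli (M v) := by
  have hone : (N 1).IsHermitian := (hN.1.map_posSemidef Matrix.PosSemidef.one).1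
  -- Hermiticity is preserved because pauli v is a difference of the positive matrices ‖v‖ + pauli v
  -- and ‖v‖.
  have hherm : ∀ v, (N (pauli v)).IsHermitian := by
    intro v
    have h1 := (hN.1.map_posSemidef (posSemidef_smul_one_add_pauli (le_refl ‖v‖))).1
    have h2 : ((‖v‖ : ℂ) • N 1).IsHermitian := by
      rw [Matrix.IsHermitian, Matrix.conjTranspose_smul, hone.eq]
      simp
    have h3 := h1.sub h2
    rwa [map_add, map_smul, add_sub_cancel_left] at h3
  refine ⟨LinearMap.toContinuousLinearMap
    (blochVector ∘ₗ (N.restrictScalars ℝ) ∘ₗ pauli), blochVector (N 1 - 1), ?_, fun v => ?_⟩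
  · rw [pauli_blochVector (hone.sub Matrix.isHermitian_one)]
    · abel
    · rw [Matrix.trace_sub, hN.2, sub_self]
  · have h := pauli_blochVector (hherm v) (by rw [hN.2, trace_pauli])
    exact h.symm

section bloch

variable {N : Matrix (Fin 2) (Fin 2) ℂ →ₗ[ℂ] Matrix (Fin 2) (Fin 2) ℂ}
  {M : EuclideanSpace ℝ (Fin 3) →L[ℝ] EuclideanSpace ℝ (Fin 3)} {c : EuclideanSpace ℝ (Fin 3)}

/-- A positive map sends the Bloch ball into itself, in its dual form. -/
theorem norm_adjoint_add_abs_inner_le (hN : IsChannel N) (h1 : N 1 = 1 + pauli c)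
    (hM : ∀ v, N (pauli v) = pauli (M v)) (b : EuclideanSpace ℝ (Fin 3)) :
    ‖ContinuousLinearMap.adjoint M b‖ + |inner ℝ b c| ≤ ‖b‖ := by
  have hball : ∀ r : EuclideanSpace ℝ (Fin 3), ‖r‖ = 1 →
      inner ℝ b c + inner ℝ b (M r) ≤ ‖b‖ ∧ -‖b‖ ≤ inner ℝ b c + inner ℝ b (M r) := by
    intro r hr
    have hp := hN.1.map_posSemidef (posSemidef_smul_one_add_pauli (a := 1) hr.le)
    have e : N (((1 : ℝ) : ℂ) • 1 + pauli r) = ((1 : ℝ) : ℂ) • 1 + pauli (c + M r) := by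
      rw [map_add, map_smul, h1, hM, map_add]
      simp [add_assoc]
    rw [e] at hp
    have h2 := norm_le_of_posSemidef hp
    have h3 := abs_real_inner_le_norm b (c + M r)
    rw [inner_add_right] at h3
    have h4 : ‖b‖ * ‖c + M r‖ ≤ ‖b‖ := by nlinarith [norm_nonneg b]
    have h5 := abs_le.1 (h3.trans h4)
    exact ⟨h5.2, h5.1⟩
  -- The unit vector along M*b; its antipode serves for the other sign of ⟨b, c⟩.
  obtain ⟨r, hr, hi⟩ : ∃ r : EuclideanSpace ℝ (Fin 3), ‖r‖ = 1 ∧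
      inner ℝ b (M r) = ‖ContinuousLinearMap.adjoint M b‖ := by
    simp only [← ContinuousLinearMap.adjoint_inner_left]
    generalize ContinuousLinearMap.adjoint M b = m
    rcases eq_or_ne m 0 with rfl | hm
    · exact ⟨EuclideanSpace.single 0 1, by simp, by simp⟩
    · refine ⟨‖m‖⁻¹ • m, norm_smul_inv_norm hm, ?_⟩
      rw [inner_smul_right, real_inner_self_eq_norm_sq]
      field_simp
  have h2 := hball r hr
  have h3 := hball (-r) (by rw [norm_neg, hr])
  rw [map_neg, inner_neg_right, hi] at h3
  rw [hi] at h2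
  rcases abs_cases (inner ℝ b c : ℝ) with ⟨h, _⟩ | ⟨h, _⟩ <;> rw [h] <;> linarith [h2.1, h3.2]

/-- Used with m = ‖M*b‖, n = ‖b‖, s = ⟨M*b, r⟩, κ = ⟨b, c⟩. The worst case is |s + κ| = |s| + n - m,
where m(n² - (s + κ)²) - n(m² - s²) equals (m - |s|)²(n - m). -/
theorem sq_sub_sq_le_of_add_abs_le {m n s κ k : ℝ} (hs : |s| ≤ m) (hκ : m + |κ| ≤ n)
    (hk : m ≤ k * n) : m ^ 2 - s ^ 2 ≤ k * (n ^ 2 - (s + κ) ^ 2) := by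
  have hm : 0 ≤ m := (abs_nonneg s).trans hs
  have hn : 0 ≤ n := by linarith [abs_nonneg κ]
  have h1 : |s + κ| ≤ |s| + n - m := by linarith [abs_add_le s κ]
  have h2 : (s + κ) ^ 2 ≤ (|s| + n - m) ^ 2 := by
    rw [← sq_abs (s + κ)]
    exact pow_le_pow_left₀ (abs_nonneg _) h1 2
  have hmn : m ≤ n := by linarith [abs_nonneg κ]
  have h3 : 0 ≤ n ^ 2 - (s + κ) ^ 2 := by
    nlinarith [abs_nonneg s, abs_nonneg (s + κ)]
  rcases hn.eq_or_lt with h | h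
  · subst h
    have : m = 0 := le_antisymm hmn hm
    have h0 : s = 0 := abs_nonpos_iff.1 (this ▸ hs)
    have h0' : κ = 0 := abs_nonpos_iff.1 (by linarith)
    simp [this, h0, h0']
  · have h4 : n * (m ^ 2 - s ^ 2) ≤ m * (n ^ 2 - (s + κ) ^ 2) := by
      have h5 : n * (m ^ 2 - |s| ^ 2) ≤ m * (n ^ 2 - (|s| + n - m) ^ 2) := by
        nlinarith [mul_nonneg (mul_nonneg (sub_nonneg.2 hs) (sub_nonneg.2 hs)) (sub_nonneg.2 hmn)]
      rw [sq_abs] at h5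
      nlinarith [mul_le_mul_of_nonneg_left h2 hm]
    have h6 : m * (n ^ 2 - (s + κ) ^ 2) ≤ k * n * (n ^ 2 - (s + κ) ^ 2) :=
      mul_le_mul_of_nonneg_right hk h3
    exact le_of_mul_le_mul_left (by linarith) h

/-- A qubit channel contracts the quantum Fisher information by the norm of its Bloch matrix. -/
theorem QFIBound.map_of_bloch (hN : IsChannel N) (h1 : N 1 = 1 + pauli c)
    (hM : ∀ v, N (pauli v) = pauli (M v)) {k : ℝ}
    (hk : ∀ b, ‖ContinuousLinearMap.adjoint M b‖ ≤ k * ‖b‖) {ρ D : Matrix (Fin 2) (Fin 2) ℂ}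
    (hρ : IsState ρ) (hD : D.IsHermitian) (hD0 : D.trace = 0) {f : ℝ} (hf : 0 ≤ f)
    (hk0 : 0 ≤ k) (h : QFIBound ρ D f) : QFIBound (N ρ) (N D) (k * f) := by
  obtain ⟨r, hr, rfl⟩ := hρ.exists_bloch
  rw [← pauli_blochVector hD hD0] at h ⊢
  generalize blochVector D = v at h
  intro B hB
  obtain ⟨a, b, rfl⟩ := exists_eq_smul_one_add_pauli hB
  have htr : ∀ (a : ℝ) (b v : EuclideanSpace ℝ (Fin 3)),
      (((a : ℂ) • 1 + pauli b) * pauli v).trace.re = 2 * inner ℝ b v := by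
    intro a b v
    rw [add_mul, smul_mul_assoc, one_mul, Matrix.trace_add, Matrix.trace_smul, trace_pauli,
      smul_zero, zero_add, trace_pauli_mul_pauli]
  have hNρ : N ((1 / 2 : ℂ) • (1 + pauli r)) = (1 / 2 : ℂ) • (1 + pauli (c + M r)) := by
    rw [map_smul, map_add, h1, hM, map_add, add_assoc]
  rw [hM, htr, hNρ, trace_pauli_sq]
  set m := ContinuousLinearMap.adjoint M b with hm
  have e1 : inner ℝ b (M v) = inner ℝ m v := (ContinuousLinearMap.adjoint_inner_left M v b).symm
  have e2 : inner ℝ b (M r) = inner ℝ m r := (ContinuousLinearMap.adjoint_inner_left M r b).symm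
  -- The scalar part does not affect the trace against the traceless D, so it is chosen to minimise
  -- Tr ρB².
  have hB' := h (((-inner ℝ m r : ℝ) : ℂ) • 1 + pauli m) (by
    refine Matrix.IsHermitian.add ?_ (isHermitian_pauli m)
    rw [Matrix.IsHermitian, Matrix.conjTranspose_smul]
    simp)
  rw [htr, trace_pauli_sq] at hB'
  rw [e1, inner_add_right, e2]
  have hs : |inner ℝ m r| ≤ ‖m‖ := by
    refine (abs_real_inner_le_norm m r).trans ?_
    nlinarith [norm_nonneg m]
  have key := sq_sub_sq_le_of_add_abs_le hs
    (norm_adjoint_add_abs_inner_le hN h1 hM b) (hk b)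
  have h5 : ‖m‖ ^ 2 - inner ℝ m r ^ 2 ≤
      k * (a ^ 2 + ‖b‖ ^ 2 + 2 * a * (inner ℝ b c + inner ℝ m r)) := by
    refine key.trans (mul_le_mul_of_nonneg_left ?_ hk0)
    nlinarith [sq_nonneg (a + (inner ℝ m r + inner ℝ b c))]
  nlinarith [mul_le_mul_of_nonneg_left h5 hf]

end bloch

/-- Monotonicity of the quantum Fisher information of qubit states under channels. -/
theorem QFIBound.map {N : Matrix (Fin 2) (Fin 2) ℂ →ₗ[ℂ] Matrix (Fin 2) (Fin 2) ℂ}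
    (hN : IsChannel N) {ρ D : Matrix (Fin 2) (Fin 2) ℂ} (hρ : IsState ρ) (hD : D.IsHermitian)
    (hD0 : D.trace = 0) {f : ℝ} (hf : 0 ≤ f) (h : QFIBound ρ D f) :
    QFIBound (N ρ) (N D) f := by
  obtain ⟨M, c, h1, hM⟩ := hN.exists_bloch
  rw [← one_mul f]
  refine QFIBound.map_of_bloch hN h1 hM (fun b => ?_) hρ hD hD0 hf zero_le_one h
  linarith [norm_adjoint_add_abs_inner_le hN h1 hM b, abs_nonneg (inner ℝ b c : ℝ)]

/-- The norm is attained on the compact unit sphere, so the strict inequality survives the supremum.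
-/
theorem ContinuousLinearMap.norm_lt_one_of_forall_norm_lt {V : Type*} [NormedAddCommGroup V]
    [NormedSpace ℝ V] [FiniteDimensional ℝ V] (M : V →L[ℝ] V)
    (h : ∀ v, v ≠ 0 → ‖M v‖ < ‖v‖) : ‖M‖ < 1 := by
  rcases subsingleton_or_nontrivial V with _ | _
  · rw [Subsingleton.elim M 0, norm_zero]
    exact zero_lt_one
  have hne : (Metric.sphere (0 : V) 1).Nonempty := NormedSpace.sphere_nonempty.2 zero_le_one
  obtain ⟨x, hx, hmax⟩ := (isCompact_sphere (0 : V) 1).exists_isMaxOn hne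
    (f := fun v => ‖M v‖) (by fun_prop)
  have hx1 : ‖x‖ = 1 := by simpa using hx
  have hlt := h x (by rintro rfl; simp at hx1)
  rw [hx1] at hlt
  refine lt_of_le_of_lt (M.opNorm_le_of_unit_norm (norm_nonneg _) fun v hv => ?_) hlt
  exact hmax (by simpa using hv)

/-- A strictly contractive qubit channel strictly contracts the quantum Fisher information. -/
theorem IsStrictlyContractive.exists_qfiBound_map
    {N : Matrix (Fin 2) (Fin 2) ℂ →ₗ[ℂ] Matrix (Fin 2) (Fin 2) ℂ}
    (hN : IsChannel N) (hc : IsStrictlyContractive N) :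
    ∃ k : ℝ, 0 ≤ k ∧ k < 1 ∧ ∀ (ρ D : Matrix (Fin 2) (Fin 2) ℂ), IsState ρ → D.IsHermitian →
      D.trace = 0 → ∀ f : ℝ, 0 ≤ f → QFIBound ρ D f → QFIBound (N ρ) (N D) (k * f) := by
  obtain ⟨M, c, h1, hM⟩ := hN.exists_bloch
  have hlt : ‖M‖ < 1 := by
    refine M.norm_lt_one_of_forall_norm_lt fun v hv => ?_
    have hv0 : pauli v ≠ 0 := by
      intro h0
      have h2 := pauli_mul_self v
      rw [h0, zero_mul] at h2
      have h3 := congrFun (congrFun h2 0) 0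
      simp at h3
      exact hv (by simpa using h3.symm)
    have := hc (pauli v) (isHermitian_pauli v) (trace_pauli v) hv0
    rw [hM, traceNorm_pauli, traceNorm_pauli] at this
    linarith
  refine ⟨‖M‖, norm_nonneg _, hlt, fun ρ D hρ hD hD0 f hf h => ?_⟩
  refine QFIBound.map_of_bloch hN h1 hM (fun b => ?_) hρ hD hD0 hf (norm_nonneg _) h
  have := (ContinuousLinearMap.adjoint M).le_opNorm b
  rwa [LinearIsometryEquiv.norm_map] at this

/-! ### Finiteness of the channel QFI -/

/-- The (unnormalised) Choi matrix of a qubit map. -/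
def choi (Φ : Matrix (Fin 2) (Fin 2) ℂ →ₗ[ℂ] Matrix (Fin 2) (Fin 2) ℂ) :
    Matrix (Fin 2 × Fin 2) (Fin 2 × Fin 2) ℂ :=
  Matrix.of fun p q => Φ (Matrix.single p.1 q.1 1) p.2 q.2

theorem IsCompletelyPositive.posSemidef_choi
    {Φ : Matrix (Fin 2) (Fin 2) ℂ →ₗ[ℂ] Matrix (Fin 2) (Fin 2) ℂ}
    (hΦ : IsCompletelyPositive Φ) : (choi Φ).PosSemidef := by
  refine hΦ 2 (Matrix.of fun i j => Matrix.single i j 1) ?_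
  have h := Matrix.posSemidef_vecMulVec_self_star
    (fun p : Fin 2 × Fin 2 => if p.1 = p.2 then (1 : ℂ) else 0)
  convert h using 1
  ext ⟨i, a⟩ ⟨j, b⟩
  simp [Matrix.vecMulVec_apply, Matrix.single_apply, ite_and]
  split_ifs <;> rfl

/-- Turns an input A with an observable B on the output into one observable on the Choi matrix, so
that a bound for the latter covers all inputs at once. -/
theorem trace_kronecker_mul_choi
    (Φ : Matrix (Fin 2) (Fin 2) ℂ →ₗ[ℂ] Matrix (Fin 2) (Fin 2) ℂ)
    (A B : Matrix (Fin 2) (Fin 2) ℂ) :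
    ((Aᵀ ⊗ₖ B) * choi Φ).trace = (B * Φ A).trace := by
  simp only [Matrix.trace_fin_two, Matrix.mul_apply, Fin.sum_univ_two, apply_eq_sum Φ A]
  simp only [Matrix.trace, Matrix.diag_apply, Matrix.mul_apply, Fintype.sum_prod_type,
    Fin.sum_univ_two, Matrix.kroneckerMap_apply, Matrix.transpose_apply, choi, Matrix.of_apply]
  ring

theorem matDeriv_trace_kronecker_mul_choi
    {E : ℝ → Matrix (Fin 2) (Fin 2) ℂ →ₗ[ℂ] Matrix (Fin 2) (Fin 2) ℂ} {θ : ℝ}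
    (hE : ∀ A, MatDifferentiableAt (fun t => E t A) θ) (A B : Matrix (Fin 2) (Fin 2) ℂ) :
    ((Aᵀ ⊗ₖ B) * matDeriv (fun t => choi (E t)) θ).trace =
      (B * matDeriv (fun t => E t A) θ).trace := by
  have htr : ∀ {d : Type} [Fintype d] (ρ : ℝ → Matrix d d ℂ) (X : Matrix d d ℂ),
      MatDifferentiableAt ρ θ →
      HasDerivAt (fun t => (X * ρ t).trace) (X * matDeriv ρ θ).trace θ := by
    intro d _ ρ X hρ
    simp only [Matrix.trace, Matrix.diag_apply, Matrix.mul_apply]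
    exact HasDerivAt.fun_sum fun i _ => HasDerivAt.fun_sum fun j _ =>
      (hρ j i).hasDerivAt.const_mul _
  have h1 := htr (fun t => choi (E t)) (Aᵀ ⊗ₖ B) fun p q => hE _ p.2 q.2
  have h2 := htr (fun t => E t A) B (hE A)
  simp only [trace_kronecker_mul_choi] at h1
  exact h1.unique h2

/-- By Cayley–Hamilton with unit trace, ρ - ρ² = (det ρ) · 1. -/
theorem IsState.posSemidef_sub_sq {ρ : Matrix (Fin 2) (Fin 2) ℂ} (h : IsState ρ) :
    (ρ - ρ * ρ).PosSemidef := by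
  have hdet := h.1.det_nonneg
  have htr := h.2
  rw [Matrix.trace_fin_two] at htr
  have e : ρ - ρ * ρ = ρ.det • 1 := by
    have h11 : ρ 1 1 = 1 - ρ 0 0 := by linear_combination htr
    rw [Matrix.det_fin_two]
    ext i j
    fin_cases i <;> fin_cases j <;> simp [Matrix.mul_apply, Fin.sum_univ_two, h11] <;> ring
  rw [e]
  exact Matrix.PosSemidef.one.smul hdet

/-- The channel QFI is finite: it is bounded by the QFI of the Choi matrix. -/
theorem channelQFI_lt_top
    {E : ℝ → Matrix (Fin 2) (Fin 2) ℂ →ₗ[ℂ] Matrix (Fin 2) (Fin 2) ℂ} {θ : ℝ}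
    (hE : IsChannelFamilyAt E θ) : channelQFI E θ < ∞ := by
  have hJ : ∀ᶠ t in 𝓝 θ, (choi (E t)).PosSemidef := hE.1.mono fun t ht => ht.1.posSemidef_choi
  have hJd : MatDifferentiableAt (fun t => choi (E t)) θ := fun p q => hE.2 _ p.2 q.2
  set f := (qfi (fun t => choi (E t)) θ).toReal with hf
  have hf0 : 0 ≤ f := ENNReal.toReal_nonneg
  have hb : QFIBound (choi (E θ)) (matDeriv (fun t => choi (E t)) θ) f := by
    rw [← qfi_le_ofReal_iff hJ hJd hf0, hf, ENNReal.ofReal_toReal (qfi_ne_top hJ hJd)]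
  refine lt_of_le_of_lt (iSup₂_le fun ρ hρ => ?_) (ENNReal.ofReal_lt_top (r := f))
  have hfam := hE.isStateFamilyAt (isStateFamilyAt_const hρ θ)
  rw [qfi_le_ofReal_iff hfam.posSemidef hfam.2 hf0]
  intro B hB
  have hX : (ρᵀ ⊗ₖ B).IsHermitian := by
    rw [Matrix.IsHermitian, Matrix.conjTranspose_kronecker, hB.eq, hρ.1.1.transpose.eq]
  have h1 := hb _ hX
  rw [matDeriv_trace_kronecker_mul_choi hE.2, Matrix.trace_mul_comm (choi _),
    ← Matrix.mul_kronecker_mul, ← Matrix.transpose_mul, trace_kronecker_mul_choi] at h1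
  refine h1.trans (mul_le_mul_of_nonneg_left ?_ hf0)
  -- The square of ρᵀ ⊗ B produces E(ρ²) in place of E(ρ); positivity of the channel and ρ² ≤ ρ
  -- absorb the difference.
  have hpos : (E θ (ρ - ρ * ρ)).PosSemidef :=
    hE.1.self_of_nhds.1.map_posSemidef hρ.posSemidef_sub_sq
  have h2 := trace_mul_sq_nonneg hpos hB
  rw [map_sub, Matrix.sub_mul, Matrix.trace_sub, Complex.sub_re] at h2
  rw [Matrix.trace_mul_comm]
  linarith

/-! ### Recursion for the sequential strategy -/

section sequential

variable {E : ℝ → Matrix (Fin 2) (Fin 2) ℂ →ₗ[ℂ] Matrix (Fin 2) (Fin 2) ℂ} {θ : ℝ}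
  {C : ℕ → Matrix (Fin 2) (Fin 2) ℂ →ₗ[ℂ] Matrix (Fin 2) (Fin 2) ℂ}

theorem qfi_map_le_mul_of_qfiBound_map
    {N : Matrix (Fin 2) (Fin 2) ℂ →ₗ[ℂ] Matrix (Fin 2) (Fin 2) ℂ} (hN : IsChannel N)
    {σ : ℝ → Matrix (Fin 2) (Fin 2) ℂ} (hσ : IsStateFamilyAt σ θ) {k : ℝ} (hk : 0 ≤ k)
    (h : ∀ f : ℝ, 0 ≤ f → QFIBound (σ θ) (matDeriv σ θ) f →
      QFIBound (N (σ θ)) (N (matDeriv σ θ)) (k * f)) :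
    qfi (fun t => N (σ t)) θ ≤ ENNReal.ofReal k * qfi σ θ := by
  have hfin := qfi_ne_top hσ.posSemidef hσ.2
  have hNσ := (hN.isChannelFamilyAt θ).isStateFamilyAt hσ
  rw [← ENNReal.ofReal_toReal hfin, ← ENNReal.ofReal_mul hk,
    qfi_le_ofReal_iff hNσ.posSemidef hNσ.2 (mul_nonneg hk ENNReal.toReal_nonneg),
    matDeriv_map N hσ.2]
  refine h _ ENNReal.toReal_nonneg ?_
  rw [← qfi_le_ofReal_iff hσ.posSemidef hσ.2 ENNReal.toReal_nonneg, ENNReal.ofReal_toReal hfin]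

/-- The contraction coefficient of a strictly contractive qubit channel is less than one. -/
theorem IsStrictlyContractive.qfiContraction_lt_one
    {N : Matrix (Fin 2) (Fin 2) ℂ →ₗ[ℂ] Matrix (Fin 2) (Fin 2) ℂ} (hN : IsChannel N)
    (hc : IsStrictlyContractive N) : qfiContraction N < 1 := by
  obtain ⟨k, hk0, hk1, hk⟩ := hc.exists_qfiBound_map hN
  refine lt_of_le_of_lt (?_ : _ ≤ ENNReal.ofReal k) (by simpa using hk1)
  refine iSup₂_le fun σ θ => iSup₂_le fun hσ _ => ENNReal.div_le_of_le_mul ?_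
  exact qfi_map_le_mul_of_qfiBound_map hN hσ hk0 fun f hf h =>
    hk _ _ hσ.1.self_of_nhds (isHermitian_matDeriv hσ.posSemidef hσ.2) hσ.trace_matDeriv f hf h

theorem qfi_map_le {N : Matrix (Fin 2) (Fin 2) ℂ →ₗ[ℂ] Matrix (Fin 2) (Fin 2) ℂ}
    (hN : IsChannel N) {σ : ℝ → Matrix (Fin 2) (Fin 2) ℂ} (hσ : IsStateFamilyAt σ θ) :
    qfi (fun t => N (σ t)) θ ≤ qfi σ θ := by
  have := qfi_map_le_mul_of_qfiBound_map hN hσ zero_le_one fun f hf h => by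
    rw [one_mul]
    exact h.map hN hσ.1.self_of_nhds (isHermitian_matDeriv hσ.posSemidef hσ.2)
      hσ.trace_matDeriv hf
  simpa using this

/-- Families of zero QFI are left out of the supremum; their derivative vanishes, hence so does the
QFI of the image. -/
theorem qfi_map_le_qfiContraction_mul {d : Type*} [Fintype d]
    {N : Matrix d d ℂ →ₗ[ℂ] Matrix d d ℂ} {σ : ℝ → Matrix d d ℂ} {θ : ℝ} (hN : IsChannel N)
    (hσ : IsStateFamilyAt σ θ) :
    qfi (fun t => N (σ t)) θ ≤ qfiContraction N * qfi σ θ := by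
  classical
  by_cases h0 : qfi σ θ = 0
  · have hNσ := (hN.isChannelFamilyAt θ).isStateFamilyAt hσ
    rw [qfi_eq_zero_iff hσ.posSemidef hσ.2] at h0
    have : qfi (fun t => N (σ t)) θ = 0 := by
      rw [qfi_eq_zero_iff hNσ.posSemidef hNσ.2, matDeriv_map N hσ.2, h0, map_zero]
    rw [this]
    exact zero_le
  · rw [← ENNReal.div_le_iff h0 (qfi_ne_top hσ.posSemidef hσ.2)]
    exact le_iSup₂_of_le σ θ (le_iSup₂_of_le hσ h0 le_rfl)

theorem isStateFamilyAt_sequential (hE : IsChannelFamilyAt E θ) (hC : ∀ k, IsChannel (C k))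
    {ρ : Matrix (Fin 2) (Fin 2) ℂ} (hρ : IsState ρ) (n : ℕ) :
    IsStateFamilyAt (fun t => sequential C E n t ρ) θ := by
  induction n with
  | zero => exact isStateFamilyAt_const hρ θ
  | succ n ih => exact ((hC (n + 1)).isChannelFamilyAt θ).isStateFamilyAt (hE.isStateFamilyAt ih)

theorem qfi_sequential_le (hE : IsChannelFamilyAt E θ) (hη : qfiContraction (E θ) < 1)
    (hC : ∀ k, IsChannel (C k)) {ρ : Matrix (Fin 2) (Fin 2) ℂ} (hρ : IsState ρ) (n : ℕ) :
    qfi (fun t => sequential C E n t ρ) θ ≤ ENNReal.ofReal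
      ((√(channelQFI E θ).toReal / (1 - √(qfiContraction (E θ)).toReal)) ^ 2) := by
  have hFtop := (channelQFI_lt_top hE).ne
  have hηtop := (hη.trans ENNReal.one_lt_top).ne
  have he1 : (qfiContraction (E θ)).toReal < 1 := by
    rw [← ENNReal.toReal_one]
    exact (ENNReal.toReal_lt_toReal hηtop ENNReal.one_ne_top).2 hη
  have he0 : 0 ≤ (qfiContraction (E θ)).toReal := ENNReal.toReal_nonneg
  have hf0 : 0 ≤ (channelQFI E θ).toReal := ENNReal.toReal_nonneg
  have hs1 : √(qfiContraction (E θ)).toReal < 1 := by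
    rw [Real.sqrt_lt' one_pos]
    simpa using he1
  set s := √(qfiContraction (E θ)).toReal with hs
  set f := √(channelQFI E θ).toReal with hf
  set G := f / (1 - s) with hG
  have hs0 : 0 ≤ s := Real.sqrt_nonneg _
  have hff : 0 ≤ f := Real.sqrt_nonneg _
  have hG0 : 0 ≤ G := div_nonneg hff (by linarith)
  -- G is the fixed point of x ↦ f + s x, so the bound √F_n ≤ G reproduces itself.
  have hfix : f + s * G = G := by
    have : 1 - s ≠ 0 := by linarith
    rw [hG]
    field_simp
    ring
  have hs2 : qfiContraction (E θ) = ENNReal.ofReal (s ^ 2) := by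
    rw [hs, Real.sq_sqrt he0, ENNReal.ofReal_toReal hηtop]
  have hf2 : channelQFI E θ = ENNReal.ofReal (f ^ 2) := by
    rw [hf, Real.sq_sqrt hf0, ENNReal.ofReal_toReal hFtop]
  have hEθ : IsChannel (E θ) := hE.1.self_of_nhds
  induction n with
  | zero =>
    have h0 := isStateFamilyAt_const hρ θ
    have : qfi (fun t => sequential C E 0 t ρ) θ = 0 :=
      (qfi_eq_zero_iff h0.posSemidef h0.2).2 (matDeriv_const ρ θ)
    rw [this]
    exact zero_le
  | succ n ih =>
    have hτ := isStateFamilyAt_sequential hE hC hρ n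
    set τ := fun t => sequential C E n t ρ with hτdef
    have hEτ := hE.isStateFamilyAt hτ
    refine (qfi_map_le (hC (n + 1)) hEτ).trans ?_
    rw [qfi_le_ofReal_iff hEτ.posSemidef hEτ.2 (sq_nonneg G), matDeriv_apply hE.2 hτ.2]
    -- Freezing the input at τ θ makes it parameter-independent, so the channel QFI bounds the first
    -- term.
    have hτθ := hE.isStateFamilyAt (isStateFamilyAt_const hτ.1.self_of_nhds θ)
    have h1 : QFIBound (E θ (τ θ)) (matDeriv (fun t => E t (τ θ)) θ) (f ^ 2) := by
      rw [← qfi_le_ofReal_iff hτθ.posSemidef hτθ.2 (sq_nonneg f), ← hf2]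
      exact le_iSup₂_of_le (τ θ) hτ.1.self_of_nhds le_rfl
    have h2 : QFIBound (E θ (τ θ)) (E θ (matDeriv τ θ)) ((s * G) ^ 2) := by
      have hN := (hEθ.isChannelFamilyAt θ).isStateFamilyAt hτ
      rw [← matDeriv_map _ hτ.2, ← qfi_le_ofReal_iff hN.posSemidef hN.2 (sq_nonneg _), mul_pow,
        ENNReal.ofReal_mul (sq_nonneg s), ← hs2]
      exact (qfi_map_le_qfiContraction_mul hEθ hτ).trans (mul_le_mul_right ih _)
    have h3 := h1.add (hEθ.map_isState hτ.1.self_of_nhds).1 hff (mul_nonneg hs0 hG0) h2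
    rwa [hfix] at h3

theorem ofReal_sq_div_eq {F η : ℝ≥0∞} (hF : F ≠ ∞) (hη : η < 1) :
    ENNReal.ofReal ((√F.toReal / (1 - √η.toReal)) ^ 2) =
      F / (1 - η ^ (1 / 2 : ℝ)) ^ 2 := by
  have hηtop := (hη.trans ENNReal.one_lt_top).ne
  have hs1 : √η.toReal < 1 := by
    rw [Real.sqrt_lt' one_pos, one_pow, ← ENNReal.toReal_one]
    exact (ENNReal.toReal_lt_toReal hηtop ENNReal.one_ne_top).2 hη
  have hs : η ^ (1 / 2 : ℝ) = ENNReal.ofReal √η.toReal := by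
    rw [Real.sqrt_eq_rpow, ← ENNReal.ofReal_rpow_of_nonneg ENNReal.toReal_nonneg (by norm_num),
      ENNReal.ofReal_toReal hηtop]
  rw [hs, div_pow, Real.sq_sqrt ENNReal.toReal_nonneg,
    ENNReal.ofReal_div_of_pos (pow_pos (sub_pos.2 hs1) 2), ENNReal.ofReal_toReal hF,
    ENNReal.ofReal_pow (sub_nonneg.2 hs1.le), ENNReal.ofReal_sub _ (Real.sqrt_nonneg _),
    ENNReal.ofReal_one]

theorem ENNReal.div_one_sub_sqrt_sq_lt_top {F η : ℝ≥0∞} (hF : F < ∞) (hη : η < 1) :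
    F / (1 - η ^ (1 / 2 : ℝ)) ^ 2 < ∞ := by
  rw [← ofReal_sq_div_eq hF.ne hη]
  exact ENNReal.ofReal_lt_top

/-! ### Achievability by replacement controls and pure inputs -/

theorem isChannel_id {d : Type*} [Fintype d] :
    IsChannel (LinearMap.id : Matrix d d ℂ →ₗ[ℂ] Matrix d d ℂ) :=
  ⟨fun _ _ hX => hX, fun _ => rfl⟩

theorem isChannel_replacement {d : Type*} [Fintype d] {ψ : Matrix d d ℂ} (hψ : IsState ψ) :
    IsChannel (replacement ψ) := by
  classical
  refine ⟨fun k X hX => ?_, fun A => ?_⟩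
  · have h1 : (∑ a, (Matrix.comp (Fin k) (Fin k) d d ℂ X).submatrix (fun i => (i, a))
        (fun i => (i, a))).PosSemidef :=
      Matrix.posSemidef_sum _ fun a _ => hX.submatrix _
    -- The ampliation is the partial trace of X over the second factor, tensored with ψ.
    have e : Matrix.comp (Fin k) (Fin k) d d ℂ (X.map (replacement ψ)) =
        (∑ a, (Matrix.comp (Fin k) (Fin k) d d ℂ X).submatrix (fun i => (i, a))
          (fun i => (i, a))) ⊗ₖ ψ := by
      ext ⟨i, a⟩ ⟨j, b⟩
      simp [replacement, Matrix.trace, Matrix.sum_apply]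
    rw [e]
    exact h1.kronecker hψ.1
  · simp [replacement, hψ.2]

theorem trace_sequential {d : Type*} [Fintype d]
    {C : ℕ → Matrix d d ℂ →ₗ[ℂ] Matrix d d ℂ} {E : ℝ → Matrix d d ℂ →ₗ[ℂ] Matrix d d ℂ} {t : ℝ}
    (hC : ∀ k, IsChannel (C k)) (ht : IsChannel (E t)) (n : ℕ) (A : Matrix d d ℂ) :
    (sequential C E n t A).trace = A.trace := by
  induction n with
  | zero => rfl
  | succ n ih => exact ((hC _).2 _).trans ((ht.2 _).trans ih)

/-- With a replacement channel in the last step but one and no control at the end, the strategy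
only uses the last channel, on the prepared state. -/
theorem channelQFI_sequential_replacement {d : Type*} [Fintype d]
    {C : ℕ → Matrix d d ℂ →ₗ[ℂ] Matrix d d ℂ} {E : ℝ → Matrix d d ℂ →ₗ[ℂ] Matrix d d ℂ} {θ : ℝ}
    (hE : IsChannelFamilyAt E θ) (hC : ∀ k, IsChannel (C k)) {ψ : Matrix d d ℂ} (hψ : IsState ψ)
    {n : ℕ} (hn : 2 ≤ n) (h1 : C (n - 1) = replacement ψ) (h2 : C n = LinearMap.id) :
    channelQFI (sequential C E n) θ = qfi (fun t => E t ψ) θ := by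
  obtain ⟨m, rfl⟩ := Nat.exists_eq_add_of_le' hn
  have key : ∀ ρ, IsState ρ →
      qfi (fun t => sequential C E (m + 2) t ρ) θ = qfi (fun t => E t ψ) θ := by
    intro ρ hρ
    refine qfi_congr ?_
    filter_upwards [hE.1] with t ht
    have e : sequential C E (m + 2) t ρ =
        C (m + 2) (E t (C (m + 2 - 1) (E t (sequential C E m t ρ)))) := rfl
    have htr : (E t (sequential C E m t ρ)).trace = 1 := by
      rw [ht.2, trace_sequential hC ht, hρ.2]
    rw [e, h1, h2]
    simp [replacement, htr]
  refine le_antisymm (iSup₂_le fun ρ hρ => (key ρ hρ).le) ?_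
  exact le_iSup₂_of_le ψ hψ (key ψ hψ).ge

theorem channelQFI_le_optimalQFI {d : Type*} [Fintype d]
    {E : ℝ → Matrix d d ℂ →ₗ[ℂ] Matrix d d ℂ} {θ : ℝ}
    (hE : IsChannelFamilyAt E θ) {n : ℕ} (hn : 1 ≤ n) : channelQFI E θ ≤ optimalQFI E n θ := by
  rcases hn.eq_or_lt with rfl | hn
  -- For n = 1 no control precedes the only use, and the input itself is optimised.
  · exact le_iSup₂_of_le (fun _ => LinearMap.id) (fun _ => isChannel_id) le_rfl
  · refine iSup₂_le fun ψ hψ => ?_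
    have hC : ∀ k, IsChannel (if k = n - 1 then replacement ψ else LinearMap.id) := by
      intro k
      split_ifs
      exacts [isChannel_replacement hψ, isChannel_id]
    refine le_iSup₂_of_le _ hC
      (channelQFI_sequential_replacement hE hC hψ hn (if_pos rfl) (if_neg ?_)).ge
    omega

/-- A positive channel QFI is witnessed by a pure input state. -/
theorem exists_pure_qfi_pos {d : Type*} [Fintype d]
    {E : ℝ → Matrix d d ℂ →ₗ[ℂ] Matrix d d ℂ} {θ : ℝ}
    (hE : IsChannelFamilyAt E θ) (h : 0 < channelQFI E θ) :
    ∃ v : d → ℂ, IsState (Matrix.vecMulVec v (star v)) ∧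
      0 < qfi (fun t => E t (Matrix.vecMulVec v (star v))) θ := by
  classical
  by_contra! hc
  refine h.ne' (nonpos_iff_eq_zero.1 (iSup₂_le fun ρ hρ => ?_))
  have hadd : ∀ c : ℂ, ∀ A B : Matrix d d ℂ, matDeriv (fun t => E t (c • A + B)) θ =
      c • matDeriv (fun t => E t A) θ + matDeriv (fun t => E t B) θ := by
    intro c A B
    ext i j
    simp only [map_add, map_smul, matDeriv, Matrix.of_apply, Matrix.add_apply, Matrix.smul_apply]
    exact (((hE.2 A i j).hasDerivAt.const_smul c).add (hE.2 B i j).hasDerivAt).deriv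
  -- The derivative is linear in the input. If it vanishes on all pure states, it vanishes on their
  -- combinations, hence on every state.
  let D : Matrix d d ℂ →ₗ[ℂ] Matrix d d ℂ :=
    { toFun := fun A => matDeriv (fun t => E t A) θ
      map_add' := fun A B => by simpa using hadd 1 A B
      map_smul' := fun c A => by
        simpa [matDeriv_const] using hadd c A 0 }
  have hpure : ∀ v : d → ℂ, D (Matrix.vecMulVec v (star v)) = 0 := by
    intro v
    rcases eq_or_ne v 0 with rfl | hv
    · simp
    set r : ℝ := ∑ i, ‖v i‖ ^ 2 with hr
    have hr0 : 0 < r := by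
      obtain ⟨i, hi⟩ := Function.ne_iff.1 hv
      exact Finset.sum_pos' (fun i _ => sq_nonneg _) ⟨i, Finset.mem_univ i, by
        have := norm_pos_iff.2 hi
        positivity⟩
    have htr : (Matrix.vecMulVec v (star v)).trace = r := by
      simp [Matrix.trace, Matrix.vecMulVec_apply, hr, Complex.mul_conj, Complex.normSq_eq_norm_sq]
    have hsq : (√r : ℂ)⁻¹ * (√r : ℂ)⁻¹ = (r : ℂ)⁻¹ := by
      rw [← mul_inv, ← Complex.ofReal_mul, Real.mul_self_sqrt hr0.le]
    have e : Matrix.vecMulVec ((√r : ℂ)⁻¹ • v) (star ((√r : ℂ)⁻¹ • v)) =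
        (r : ℂ)⁻¹ • Matrix.vecMulVec v (star v) := by
      rw [star_smul, Matrix.smul_vecMulVec, Matrix.vecMulVec_smul, smul_smul, ← hsq]
      simp
    have hst : IsState (Matrix.vecMulVec ((√r : ℂ)⁻¹ • v) (star ((√r : ℂ)⁻¹ • v))) := by
      refine ⟨Matrix.posSemidef_vecMulVec_self_star _, ?_⟩
      rw [e, Matrix.trace_smul, htr, smul_eq_mul, inv_mul_cancel₀]
      exact_mod_cast hr0.ne'
    have hfam := hE.isStateFamilyAt (isStateFamilyAt_const hst θ)
    have h0 : D (Matrix.vecMulVec ((√r : ℂ)⁻¹ • v) (star ((√r : ℂ)⁻¹ • v))) = 0 :=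
      (qfi_eq_zero_iff hfam.posSemidef hfam.2).1 (nonpos_iff_eq_zero.1 (hc _ hst))
    rw [e, map_smul, smul_eq_zero] at h0
    refine h0.resolve_left (inv_ne_zero ?_)
    exact_mod_cast hr0.ne'
  have hfam := hE.isStateFamilyAt (isStateFamilyAt_const hρ θ)
  refine ((qfi_eq_zero_iff hfam.posSemidef hfam.2).2 ?_).le
  obtain ⟨m, v, hv⟩ := Matrix.posSemidef_iff_eq_sum_vecMulVec.1 hρ.1
  change D ρ = 0
  rw [hv, map_sum]
  exact Finset.sum_eq_zero fun i _ => hpure _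

end sequential

theorem theorem5
    (E : ℝ → Matrix (Fin 2) (Fin 2) ℂ →ₗ[ℂ] Matrix (Fin 2) (Fin 2) ℂ) (θ : ℝ)
    (hE : IsChannelFamilyAt E θ) (hcontr : IsStrictlyContractive (E θ)) :
    -- the contraction coefficient is smaller than one
    qfiContraction (E θ) < 1 ∧
    -- the upper bound, for every number of uses of the channel
    (∀ n : ℕ, optimalQFI E n θ ≤
      channelQFI E θ / (1 - qfiContraction (E θ) ^ (1 / 2 : ℝ)) ^ 2) ∧
    -- the bound is a finite constant
    channelQFI E θ / (1 - qfiContraction (E θ) ^ (1 / 2 : ℝ)) ^ 2 < ∞ ∧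
    -- a constant is achieved, which is positive as soon as the channel QFI is
    (∀ n : ℕ, 1 ≤ n → channelQFI E θ ≤ optimalQFI E n θ) ∧
    -- it is achieved by a replacement channel in the last step but one
    (∀ ψ : Matrix (Fin 2) (Fin 2) ℂ, IsState ψ → IsChannel (replacement ψ) ∧
      ∀ n : ℕ, 2 ≤ n →
        ∀ C : ℕ → Matrix (Fin 2) (Fin 2) ℂ →ₗ[ℂ] Matrix (Fin 2) (Fin 2) ℂ,
          (∀ k, IsChannel (C k)) → C (n - 1) = replacement ψ → C n = LinearMap.id →
            channelQFI (sequential C E n) θ = qfi (fun t => E t ψ) θ) ∧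
    (0 < channelQFI E θ → ∃ v : Fin 2 → ℂ, IsState (Matrix.vecMulVec v (star v)) ∧
      0 < qfi (fun t => E t (Matrix.vecMulVec v (star v))) θ) := by

  have hη := hcontr.qfiContraction_lt_one hE.1.self_of_nhds
  have hF := channelQFI_lt_top hE
  refine ⟨hη, fun n => ?_, ENNReal.div_one_sub_sqrt_sq_lt_top hF hη,
    fun n hn => channelQFI_le_optimalQFI hE hn,
    fun ψ hψ => ⟨isChannel_replacement hψ, fun n hn C hC h1 h2 =>
      channelQFI_sequential_replacement hE hC hψ hn h1 h2⟩,
    exists_pure_qfi_pos hE⟩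
  rw [← ofReal_sq_div_eq hF.ne hη]
  exact iSup₂_le fun C hC => iSup₂_le fun ρ hρ => qfi_sequential_le hE hη hC hρ n
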